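/- For a complex number $q$ with $|q|>1$ consider the $q$-algebraic equation $P_q(z,Y_0,Y_1,\ldots)f(z)=0$ given by the polynomial $$P_q=4Y_1^4-9Y_0^2Y_1Y_2+2Y_0^3Y_2+\frac{z}{q^4}Y_0Y_2-z^3Y_0^4Y_5^2-\frac{z^3}{q^4}Y_2-z^3Y_0+z^5 ,$$ where $Y_k$ stands for $f(q^kz)$. The unknown is a formal power series $f(z)=\sum_{n\ge 0}f_nz^{n/2}$ in $z^{1/2}$; once a square root $r$ of $q$ is chosen, $f(q^kz)=\sum_{n\geq 0}r^{kn}f_nz^{n/2}$. There is a countable set $E\subset\mathbb C$ such that for every $q\in\mathbb C\setminus E$ with $|q|>1$, every $r$ with $r^2=q$ and every $\rho$ with $$\rho^2=-q(q^2-2)(2q-1)(2q+1),$$ one has $\rho\neq 0$ and the equation has a formal power series solution in $z^{1/2}$ of the form $$f(z)=z^2+\rho z^{7/2}+o(z^{7/2})$$ whose coefficients satisfy, as $n\to\infty$, $$f_n\sim c_{q,m}\,q^{(3n^2-63n)/68}\Bigl(\frac{2}{\rho}\Bigr)^{n/17},\qquad m=n \bmod 17,\quad 0\le m<17 .$$ The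 last relation means that there are complex numbers $c_{q,0},\ldots,c_{q,16}$ (possibly zero, and depending also on $r$, $\rho$ and the determinations $L$, $M$ below) such that, for each $m$, the quotient of $f_n$ by $q^{(3n^2-63n)/68}(2/\rho)^{n/17}$ tends to $c_{q,m}$ as $n\to\infty$ with $n\equiv m \pmod{17}$. Here $q^s=e^{sL}$ and $(2/\rho)^s=e^{sM}$ with any fixed determinations $L$ of $\log q$ such that $e^{L/2}=r$ and $M$ of $\log(2/\rho)$. -/

import Mathlib

/-- The polynomial
`4 Y₁⁴ - 9 Y₀² Y₁ Y₂ + 2 Y₀³ Y₂ + (z/q⁴) Y₀ Y₂ - z³ Y₀⁴ Y₅² - (z³/q⁴) Y₂ - z³ Y₀ + z⁵`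
of Cano and Fortuny Ayuso. The variable `none` is `z`, and the variable `some k` is `Y_k`. -/
noncomputable def cfaPolynomial (q : ℂ) : MvPolynomial (Option ℕ) ℂ :=
  let z : MvPolynomial (Option ℕ) ℂ := MvPolynomial.X none
  let Y : ℕ → MvPolynomial (Option ℕ) ℂ := fun k => MvPolynomial.X (some k)
  let c : MvPolynomial (Option ℕ) ℂ := MvPolynomial.C (1 / q ^ 4)
  4 * Y 1 ^ 4 - 9 * Y 0 ^ 2 * Y 1 * Y 2 + 2 * Y 0 ^ 3 * Y 2 + c * z * Y 0 * Y 2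
    - z ^ 3 * Y 0 ^ 4 * Y 5 ^ 2 - c * z ^ 3 * Y 2 - z ^ 3 * Y 0 + z ^ 5

/-- A formal power series in `z^{1/2}`, `∑ fₙ z^{n/2}`, is represented by the power series
`∑ fₙ tⁿ` in `t = z^{1/2}`. Let `r` be the chosen square root of `q`, so that replacing `z` by
`q^k z` replaces `t` by `r^k t`. This is the series obtained from the polynomial `P(z, Y₀, Y₁, …)`
by substituting `t²` for `z` and `f(q^k z)` for each `Y_k`. -/
noncomputable def qSubst (r : ℂ) (P : MvPolynomial (Option ℕ) ℂ) (f : PowerSeries ℂ) :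
    PowerSeries ℂ :=
  MvPolynomial.aeval
    (fun v : Option ℕ => v.elim (PowerSeries.X ^ 2) (fun k => PowerSeries.rescale (r ^ k) f)) P

/-- `f`, a formal power series in `z^{1/2}`, solves the `q`-algebraic equation given by `P`, where
`q = r²` and `r` is the value of `q^{1/2}`. -/
def IsHalfPowerSolution (r : ℂ) (P : MvPolynomial (Option ℕ) ℂ) (f : PowerSeries ℂ) : Prop :=
  qSubst r P f = 0

/-- `f(z) = z² + ρ z^{7/2} + o(z^{7/2})` for a formal power series in `t = z^{1/2}`: all the other
terms of `f` have order at least `z^{8/2}`. -/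
def HasExpansion (f : PowerSeries ℂ) (ρ : ℂ) : Prop :=
  (PowerSeries.X : PowerSeries ℂ) ^ 8 ∣
    f - (PowerSeries.X ^ 4 + PowerSeries.C ρ * PowerSeries.X ^ 7)

/-- The comparison sequence `q^{(3n² - 63n)/68} (2/ρ)^{n/17}`, where the complex powers are
computed with a determination `L` of `log q` and a determination `M` of `log (2/ρ)`. -/
noncomputable def comparison (L M : ℂ) (n : ℕ) : ℂ :=
  Complex.exp (((3 * (n : ℂ) ^ 2 - 63 * (n : ℂ)) / 68) * L) * Complex.exp (((n : ℂ) / 17) * M)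

/-! Put z = t² and f = t⁴(1 + t³h). The last four terms of P_q with no Y₅ factor as (zY₂/q⁴ - z³)(Y₀
- z²), so division by t¹⁶ leaves r⁶ h(t)h(r²t) + const + t(...) = 0. The constant term of this
equation is the condition on ρ = h(0). The k-th coefficient is then linear in h_k with factor r⁶ρ(1
+ r^{2k}), nonzero since |r| > 1, so h exists.

For the growth, bound coefficients by C exp(ak² + bk) with 34a = 3 log|r|. Products preserve a and
b, t^s lowers b by 2as, and h(r^k t) raises it by k log|r|. For this a, the terms r⁶ρ h(r²t) and
2r⁵⁵ t¹⁷ h(r⁵t) both shift b by 2 log|r|, while all other nonconstant terms gain at least 2a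
(`exists_gaussBound_linear_part`). Thus h_{k+17} ≈ (2/ρ) r^{3k+15} h_k, which is exactly the
recurrence of the comparison sequence.

A majorant induction gives some initial b (`exists_gaussBound_solSeries`). Each use of the
recurrence improves b by 2a, until the quotients by the comparison sequence have geometrically
decaying increments along each class mod 17, hence converge (`exists_tendsto_coeff_div_comparison`).
-/

section GaussianGrowth

open PowerSeries

/-! ### Calculus of Gaussian coefficient bounds. -/

/-- The coefficients of `x` grow at most like `C exp (a k² + b k)`. -/
def GaussBound (a b C : ℝ) (x : PowerSeries ℂ) : Prop :=
  ∀ k : ℕ, ‖coeff k x‖ ≤ C * Real.exp (a * (k : ℝ) ^ 2 + b * k)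

theorem GaussBound.mono {a b b' C C' : ℝ} {x : PowerSeries ℂ} (h : GaussBound a b C x)
    (hb : b ≤ b') (hC : C ≤ C') (hC0 : 0 ≤ C') : GaussBound a b' C' x := by
  intro k
  refine (h k).trans ?_
  gcongr

theorem GaussBound.add {a b C C' : ℝ} {x y : PowerSeries ℂ} (hx : GaussBound a b C x)
    (hy : GaussBound a b C' y) : GaussBound a b (C + C') (x + y) := by
  intro k
  rw [map_add, add_mul]
  exact (norm_add_le _ _).trans (add_le_add (hx k) (hy k))

theorem GaussBound.neg {a b C : ℝ} {x : PowerSeries ℂ} (hx : GaussBound a b C x) :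
    GaussBound a b C (-x) := by
  intro k
  rw [map_neg, norm_neg]
  exact hx k

theorem GaussBound.const (a b : ℝ) (c : ℂ) : GaussBound a b ‖c‖ (C c) := by
  intro k
  rw [coeff_C]
  split_ifs with h
  · subst h; simp
  · rw [norm_zero]; positivity

theorem GaussBound.rescale {a b C : ℝ} {x : PowerSeries ℂ} (hx : GaussBound a b C x) {c : ℂ}
    (hc : c ≠ 0) : GaussBound a (b + Real.log ‖c‖) C (PowerSeries.rescale c x) := by
  intro k
  rw [coeff_rescale, norm_mul, norm_pow]
  have h1 : a * (k : ℝ) ^ 2 + (b + Real.log ‖c‖) * k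
      = (a * (k : ℝ) ^ 2 + b * k) + k * Real.log ‖c‖ := by ring
  rw [h1, Real.exp_add, Real.exp_nat_mul, Real.exp_log (norm_pos_iff.mpr hc)]
  calc ‖c‖ ^ k * ‖coeff k x‖ ≤ ‖c‖ ^ k * (C * Real.exp (a * (k : ℝ) ^ 2 + b * k)) := by
        gcongr; exact hx k
    _ = _ := by ring

theorem GaussBound.X_pow_mul {a b C : ℝ} {x : PowerSeries ℂ} (hx : GaussBound a b C x)
    (hC : 0 ≤ C) (s : ℕ) :
    GaussBound a (b - 2 * a * s) (C * Real.exp (a * (s : ℝ) ^ 2 - b * s)) (X ^ s * x) := by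
  intro k
  rw [coeff_X_pow_mul']
  split_ifs with h
  · refine (hx _).trans (le_of_eq ?_)
    rw [mul_assoc, ← Real.exp_add, Nat.cast_sub h]
    ring_nf
  · rw [norm_zero]; positivity

theorem GaussBound.divX {a b C : ℝ} {x : PowerSeries ℂ} (hx : GaussBound a b C x) :
    GaussBound a (b + 2 * a) (C * Real.exp (a + b)) (mk fun k => coeff (k + 1) x) := by
  intro k
  rw [coeff_mk]
  refine (hx _).trans (le_of_eq ?_)
  rw [mul_assoc, ← Real.exp_add]
  push_cast
  ring_nf

/-- A bound, uniform in `k`, for `∑_{i+j=k} exp (-2 a i j)`. -/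
noncomputable def convConst (a : ℝ) : ℝ := 1 + (1 - Real.exp (-(2 * a)))⁻¹

theorem convConst_pos {a : ℝ} (ha : 0 < a) : 0 < convConst a := by
  have : Real.exp (-(2 * a)) < 1 := by rw [Real.exp_lt_one_iff]; linarith
  have : 0 < (1 - Real.exp (-(2 * a)))⁻¹ := inv_pos.mpr (by linarith)
  unfold convConst; linarith

theorem sum_exp_antidiagonal_le {a : ℝ} (ha : 0 < a) (k : ℕ) :
    ∑ p ∈ Finset.HasAntidiagonal.antidiagonal k, Real.exp (-(2 * a * p.1 * p.2)) ≤ convConst a := by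
  rw [Finset.Nat.sum_antidiagonal_eq_sum_range_succ_mk, Finset.sum_range_succ, add_comm]
  unfold convConst
  have h1 : Real.exp (-(2 * a)) < 1 := by rw [Real.exp_lt_one_iff]; linarith
  refine add_le_add (by simp) ?_
  calc ∑ i ∈ Finset.range k, Real.exp (-(2 * a * (i : ℝ) * ((k - i : ℕ) : ℝ)))
      ≤ ∑ i ∈ Finset.range k, Real.exp (-(2 * a)) ^ i := by
        refine Finset.sum_le_sum fun i hi => ?_
        rw [← Real.exp_nat_mul]
        refine Real.exp_le_exp.mpr ?_
        have h2 : (1 : ℝ) ≤ ((k - i : ℕ) : ℝ) := by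
          have := Finset.mem_range.mp hi
          exact_mod_cast (by omega : 1 ≤ k - i)
        have h3 : 0 ≤ 2 * a * (i : ℝ) := by positivity
        nlinarith
    _ ≤ ∑' i : ℕ, Real.exp (-(2 * a)) ^ i :=
        (summable_geometric_of_lt_one (Real.exp_pos _).le h1).sum_le_tsum _
          (fun i _ => by positivity)
    _ = _ := tsum_geometric_of_lt_one (Real.exp_pos _).le h1

/-- Since i² + j² = (i+j)² - 2ij, the convolution costs only the sum of exp(-2aij) over i + j = k,
which is bounded in k. This is why a and b survive multiplication. -/
theorem GaussBound.mul {a b C C' : ℝ} {x y : PowerSeries ℂ} (ha : 0 < a) (hC : 0 ≤ C)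
    (hC' : 0 ≤ C') (hx : GaussBound a b C x) (hy : GaussBound a b C' y) :
    GaussBound a b (convConst a * C * C') (x * y) := by
  intro k
  rw [coeff_mul]
  calc ‖∑ p ∈ Finset.HasAntidiagonal.antidiagonal k, coeff p.1 x * coeff p.2 y‖
      ≤ ∑ p ∈ Finset.HasAntidiagonal.antidiagonal k, Real.exp (-(2 * a * p.1 * p.2)) *
          (C * C' * Real.exp (a * (k : ℝ) ^ 2 + b * k)) := by
        refine norm_sum_le_of_le _ fun p hp => ?_
        rw [norm_mul]
        refine (mul_le_mul (hx _) (hy _) (norm_nonneg _) (by positivity)).trans (le_of_eq ?_)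
        have hk : (k : ℝ) = p.1 + p.2 := by
          rw [← Finset.HasAntidiagonal.mem_antidiagonal.mp hp]; push_cast; ring
        rw [mul_mul_mul_comm, ← Real.exp_add, mul_left_comm, ← Real.exp_add, hk]
        ring_nf
    _ ≤ convConst a * (C * C' * Real.exp (a * (k : ℝ) ^ 2 + b * k)) := by
        rw [← Finset.sum_mul]
        exact mul_le_mul_of_nonneg_right (sum_exp_antidiagonal_le ha k) (by positivity)
    _ = _ := by ring

/-! ### Operators on series and their effect on the linear exponent. -/

/-- The map `F` shifts the linear exponent of Gaussian bounds by at most `β`, with constants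
uniform over all sufficiently large linear exponents. -/
def ShiftsBound (a β : ℝ) (F : PowerSeries ℂ → PowerSeries ℂ) : Prop :=
  ∀ M B : ℝ, 0 ≤ M → ∃ K : ℝ, 0 ≤ K ∧ ∀ b, B ≤ b → ∀ H, GaussBound a b M H →
    GaussBound a (b + β) K (F H)

theorem ShiftsBound.mono {a β β' : ℝ} {F : PowerSeries ℂ → PowerSeries ℂ}
    (h : ShiftsBound a β F) (hb : β ≤ β') : ShiftsBound a β' F := by
  intro M B hM
  obtain ⟨K, hK, h⟩ := h M B hM
  exact ⟨K, hK, fun b hB H hH => (h b hB H hH).mono (by linarith) le_rfl hK⟩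

theorem ShiftsBound.id (a : ℝ) : ShiftsBound a 0 (fun H => H) := by
  intro M B hM
  exact ⟨M, hM, fun b _ H hH => by simpa using hH⟩

theorem ShiftsBound.const (a β : ℝ) (c : ℂ) : ShiftsBound a β (fun _ => C c) :=
  fun _ _ _ => ⟨‖c‖, norm_nonneg _, fun _ _ _ _ => GaussBound.const _ _ _⟩

theorem ShiftsBound.one (a β : ℝ) : ShiftsBound a β (fun _ => 1) := by
  simpa using ShiftsBound.const a β 1

theorem ShiftsBound.ofNat (a β : ℝ) (n : ℕ) [n.AtLeastTwo] :
    ShiftsBound a β (fun _ => OfNat.ofNat n) := by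
  simpa only [map_ofNat] using ShiftsBound.const a β (OfNat.ofNat n)

theorem ShiftsBound.add {a β : ℝ} {F G : PowerSeries ℂ → PowerSeries ℂ}
    (hF : ShiftsBound a β F) (hG : ShiftsBound a β G) :
    ShiftsBound a β (fun H => F H + G H) := by
  intro M B hM
  obtain ⟨K, hK, hF⟩ := hF M B hM
  obtain ⟨K', hK', hG⟩ := hG M B hM
  exact ⟨K + K', by positivity, fun b hB H hH => (hF b hB H hH).add (hG b hB H hH)⟩

theorem ShiftsBound.neg {a β : ℝ} {F : PowerSeries ℂ → PowerSeries ℂ}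
    (hF : ShiftsBound a β F) : ShiftsBound a β (fun H => -F H) := by
  intro M B hM
  obtain ⟨K, hK, hF⟩ := hF M B hM
  exact ⟨K, hK, fun b hB H hH => (hF b hB H hH).neg⟩

theorem ShiftsBound.sub {a β : ℝ} {F G : PowerSeries ℂ → PowerSeries ℂ}
    (hF : ShiftsBound a β F) (hG : ShiftsBound a β G) :
    ShiftsBound a β (fun H => F H - G H) := by
  simpa only [sub_eq_add_neg] using hF.add hG.neg

theorem ShiftsBound.mul {a β : ℝ} (ha : 0 < a) {F G : PowerSeries ℂ → PowerSeries ℂ}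
    (hF : ShiftsBound a β F) (hG : ShiftsBound a β G) :
    ShiftsBound a β (fun H => F H * G H) := by
  intro M B hM
  obtain ⟨K, hK, hF⟩ := hF M B hM
  obtain ⟨K', hK', hG⟩ := hG M B hM
  exact ⟨convConst a * K * K', by have := convConst_pos ha; positivity,
    fun b hB H hH => (hF b hB H hH).mul ha hK hK' (hG b hB H hH)⟩

theorem ShiftsBound.pow {a β : ℝ} (ha : 0 < a) {F : PowerSeries ℂ → PowerSeries ℂ}
    (hF : ShiftsBound a β F) (n : ℕ) : ShiftsBound a β (fun H => F H ^ n) := by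
  induction n with
  | zero => simpa using ShiftsBound.one a β
  | succ n ih => simpa only [pow_succ] using ih.mul ha hF

theorem ShiftsBound.rescale {a β : ℝ} {F : PowerSeries ℂ → PowerSeries ℂ}
    (hF : ShiftsBound a β F) {c : ℂ} (hc : c ≠ 0) :
    ShiftsBound a (β + Real.log ‖c‖) (fun H => PowerSeries.rescale c (F H)) := by
  intro M B hM
  obtain ⟨K, hK, hF⟩ := hF M B hM
  refine ⟨K, hK, fun b hB H hH => ?_⟩
  rw [← add_assoc]
  exact (hF b hB H hH).rescale hc

theorem ShiftsBound.X_pow_mul {a β : ℝ} {F : PowerSeries ℂ → PowerSeries ℂ}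
    (hF : ShiftsBound a β F) (s : ℕ) :
    ShiftsBound a (β - 2 * a * s) (fun H => X ^ s * F H) := by
  intro M B hM
  obtain ⟨K, hK, hF⟩ := hF M B hM
  -- The constant contains exp(-bs), decreasing in b; the lower bound `B` makes it uniform.
  refine ⟨K * Real.exp (a * (s : ℝ) ^ 2 - (B + β) * s), by positivity, fun b hB H hH => ?_⟩
  refine ((hF b hB H hH).X_pow_mul hK s).mono (by linarith) ?_ (by positivity)
  gcongr

/-! ### The reduced equation and its negligible terms. -/

/-- The equation satisfied by `h` when `X ^ 4 * (1 + X ^ 3 * h)` is a solution, after division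
by `X ^ 16`. -/
noncomputable def reducedEqn (r : ℂ) (h : PowerSeries ℂ) : PowerSeries ℂ :=
  C (r ^ 6) * (h * rescale (r ^ 2) h)
    + 4 * C (r ^ 16) * (1 + C (r ^ 3) * (X ^ 3 * rescale r h)) ^ 4
    - 9 * C (r ^ 12) * ((1 + X ^ 3 * h) ^ 2 * (1 + C (r ^ 3) * (X ^ 3 * rescale r h))
        * (1 + C (r ^ 6) * (X ^ 3 * rescale (r ^ 2) h)))
    + 2 * C (r ^ 8) * ((1 + X ^ 3 * h) ^ 3 * (1 + C (r ^ 6) * (X ^ 3 * rescale (r ^ 2) h)))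
    - X ^ 14 * C (r ^ 40) * ((1 + X ^ 3 * h) ^ 4
        * (1 + C (r ^ 15) * (X ^ 3 * rescale (r ^ 5) h)) ^ 2)

theorem qSubst_cfaPolynomial {r : ℂ} (hr : r ≠ 0) (h : PowerSeries ℂ) :
    qSubst r (cfaPolynomial (r ^ 2)) (X ^ 4 * (1 + X ^ 3 * h)) = X ^ 16 * reducedEqn r h := by
  have hX : ∀ c : ℂ, rescale c (X : PowerSeries ℂ) = C c * X := fun c => by
    rw [rescale_X]
  have hC : C (1 / (r ^ 2) ^ 4) * C r ^ 8 = (1 : PowerSeries ℂ) := by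
    rw [← map_pow, ← map_mul, ← map_one C]
    congr 1
    field_simp
  simp only [qSubst, cfaPolynomial, reducedEqn, map_add, map_sub, map_mul, map_pow, map_ofNat,
    MvPolynomial.aeval_X, MvPolynomial.aeval_C, Option.elim, hX, map_one, pow_zero, rescale_one,
    RingHom.id_apply, PowerSeries.algebraMap_apply, Algebra.algebraMap_self]
  simp only [pow_one]
  set c := C (1 / (r ^ 2) ^ 4) with hc
  linear_combination (X ^ 6 * (X ^ 3 * h) * X ^ 4
    + X ^ 10 * (X ^ 3 * h) * C r ^ 6 * (X ^ 3 * rescale (r ^ 2) h)) * hC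

/-- The part of `reducedEqn`, divided by `X`, that has no bearing on the leading growth. The last
four arguments stand for `h(t)`, `h(r t)`, `h(r² t)` and `h(r⁵ t)`. -/
noncomputable def reducedRem (r : ℂ) (y₀ y₁ y₂ y₅ : PowerSeries ℂ) : PowerSeries ℂ :=
  4 * C (r ^ 16) * (C (r ^ 3) * (X ^ 2 * y₁) * (4 + 6 * (C (r ^ 3) * (X ^ 3 * y₁))
        + 4 * (C (r ^ 3) * (X ^ 3 * y₁)) ^ 2 + (C (r ^ 3) * (X ^ 3 * y₁)) ^ 3))
    - 9 * C (r ^ 12) * (X ^ 2 * y₀ * (2 + X ^ 3 * y₀) * (1 + C (r ^ 3) * (X ^ 3 * y₁))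
          * (1 + C (r ^ 6) * (X ^ 3 * y₂))
        + C (r ^ 3) * (X ^ 2 * y₁) * (1 + C (r ^ 6) * (X ^ 3 * y₂))
        + C (r ^ 6) * (X ^ 2 * y₂))
    + 2 * C (r ^ 8) * (X ^ 2 * y₀ * (3 + 3 * (X ^ 3 * y₀) + (X ^ 3 * y₀) ^ 2)
          * (1 + C (r ^ 6) * (X ^ 3 * y₂)) + C (r ^ 6) * (X ^ 2 * y₂))
    - C (r ^ 40) * (X ^ 13 * 1)
    - C (r ^ 40) * (X ^ 16 * (y₀ * (4 + 6 * (X ^ 3 * y₀) + 4 * (X ^ 3 * y₀) ^ 2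
          + (X ^ 3 * y₀) ^ 3) * (1 + C (r ^ 15) * (X ^ 3 * y₅)) ^ 2
        + C (r ^ 30) * (X ^ 3 * y₅ ^ 2)))

/-- `reducedRem` evaluated at the rescalings of `h`. -/
noncomputable def remainder (r : ℂ) (h : PowerSeries ℂ) : PowerSeries ℂ :=
  reducedRem r h (rescale r h) (rescale (r ^ 2) h) (rescale (r ^ 5) h)

theorem reducedEqn_eq (r : ℂ) (h : PowerSeries ℂ) :
    reducedEqn r h = C (r ^ 6) * (h * rescale (r ^ 2) h)
      + C (4 * r ^ 16 - 9 * r ^ 12 + 2 * r ^ 8)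
      + X * (remainder r h - C (2 * r ^ 55) * (X ^ 16 * rescale (r ^ 5) h)) := by
  simp only [reducedEqn, remainder, reducedRem, map_add, map_sub, map_mul, map_ofNat, map_pow]
  ring

/-- Terms without h(r⁵t) involve at most h(r²t) and carry at least t². Those from the Y₅ term carry
t¹⁶ and a further t³ for each extra factor, the term linear in h(r⁵t) alone having been removed. -/
theorem shiftsBound_remainder {a : ℝ} (ha : 0 < a) {r : ℂ} (hr : 1 < ‖r‖)
    (har : 34 * a = 3 * Real.log ‖r‖) :
    ShiftsBound a (2 * Real.log ‖r‖ - 4 * a) (remainder r) := by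
  have hr0 : r ≠ 0 := by rintro rfl; simp at hr; linarith
  set l := Real.log ‖r‖ with hl
  have hlog : ∀ k : ℕ, Real.log ‖r ^ k‖ = k * l := fun k => by rw [norm_pow, Real.log_pow]
  have h0 := ShiftsBound.id a
  have h1 := h0.rescale hr0
  have h2 := h0.rescale (pow_ne_zero 2 hr0)
  have h5 := h0.rescale (pow_ne_zero 5 hr0)
  rw [hlog] at h2 h5
  rw [← hl] at h1
  push_cast at h2 h5
  set β := 2 * l - 4 * a with hβ
  set β' := 5 * l - 6 * a with hβ'
  have low : ∀ {F : PowerSeries ℂ → PowerSeries ℂ} {b : ℝ} (s : ℕ), ShiftsBound a b F → b ≤ 2 * l →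
      2 ≤ s → ShiftsBound a β (fun H => X ^ s * F H) := fun s hF hb hs => by
    refine (hF.X_pow_mul s).mono ?_
    have : (2 : ℝ) ≤ s := by exact_mod_cast hs
    nlinarith
  have high : ∀ {F : PowerSeries ℂ → PowerSeries ℂ} {b : ℝ}, ShiftsBound a b F → b ≤ 5 * l →
      ShiftsBound a β' (fun H => X ^ 3 * F H) := fun hF hb => by
    refine (hF.X_pow_mul 3).mono ?_
    push_cast; linarith
  have v0 := low 2 h0 (by linarith) le_rfl
  have v1 := (ShiftsBound.const a β (r ^ 3)).mul ha (low 2 h1 (by linarith) le_rfl)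
  have v2 := (ShiftsBound.const a β (r ^ 6)).mul ha (low 2 h2 (by linarith) le_rfl)
  have w0 := low 3 h0 (by linarith) (by norm_num)
  have w1 := (ShiftsBound.const a β (r ^ 3)).mul ha (low 3 h1 (by linarith) (by norm_num))
  have w2 := (ShiftsBound.const a β (r ^ 6)).mul ha (low 3 h2 (by linarith) (by norm_num))
  have o := ShiftsBound.one a β
  have n2 := ShiftsBound.ofNat a β 2
  have n3 := ShiftsBound.ofNat a β 3
  have n4 := ShiftsBound.ofNat a β 4
  have n6 := ShiftsBound.ofNat a β 6
  have n9 := ShiftsBound.ofNat a β 9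
  have c := ShiftsBound.const a β
  have z0 := high h0 (by linarith)
  have z5 := (ShiftsBound.const a β' (r ^ 15)).mul ha (high h5 (by linarith))
  have y0 := h0.mono (show 0 ≤ β' by linarith)
  have q5 := high (h5.pow ha 2) (by linarith)
  -- The exponent closes because 5l - 6a - 32a = 2l - 4a, by 34a = 3l.
  have top := ((((y0.mul ha ((((ShiftsBound.ofNat a β' 4).add
      ((ShiftsBound.ofNat a β' 6).mul ha z0)).add ((ShiftsBound.ofNat a β' 4).mul ha
      (z0.pow ha 2))).add (z0.pow ha 3))).mul ha (((ShiftsBound.one a β').add z5).pow ha 2)).add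
      ((ShiftsBound.const a β' (r ^ 30)).mul ha q5)).X_pow_mul 16).mono
      (show _ ≤ β by push_cast; linarith)
  exact (((((n4.mul ha (c _)).mul ha (v1.mul ha (((n4.add (n6.mul ha w1)).add
      (n4.mul ha (w1.pow ha 2))).add (w1.pow ha 3)))).sub
    ((n9.mul ha (c _)).mul ha (((((v0.mul ha (n2.add w0)).mul ha (o.add w1)).mul ha
      (o.add w2)).add (v1.mul ha (o.add w2))).add v2))).add
    ((n2.mul ha (c _)).mul ha (((v0.mul ha ((n3.add (n3.mul ha w0)).add (w0.pow ha 2))).mul ha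
      (o.add w2)).add v2))).sub
    ((c _).mul ha (low 13 (ShiftsBound.one a 0) (by linarith) (by norm_num)))).sub
    ((c _).mul ha top)

theorem X_pow_dvd_rescale {k : ℕ} (c : ℂ) {x : PowerSeries ℂ} (h : X ^ k ∣ x) :
    X ^ k ∣ rescale c x := by
  rw [X_pow_dvd_iff] at h ⊢
  intro m hm
  rw [coeff_rescale, h m hm, mul_zero]

theorem X_pow_dvd_remainder_sub {k : ℕ} (r : ℂ) {x y : PowerSeries ℂ} (h : X ^ k ∣ x - y) :
    X ^ k ∣ remainder r x - remainder r y := by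
  -- Working in the quotient by X^k turns the claim into substitution of equal values in a
  -- polynomial.
  have key : ∀ {u v : PowerSeries ℂ}, X ^ k ∣ u - v ↔
      Ideal.Quotient.mk (Ideal.span {(X : PowerSeries ℂ) ^ k}) u
        = Ideal.Quotient.mk (Ideal.span {(X : PowerSeries ℂ) ^ k}) v := fun {u v} => by
    rw [Ideal.Quotient.eq, Ideal.mem_span_singleton]
  have hs : ∀ c : ℂ, X ^ k ∣ rescale c x - rescale c y := fun c => by
    rw [← map_sub]; exact X_pow_dvd_rescale c h
  have h0 := key.mp h
  have h1 := key.mp (hs r)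
  have h2 := key.mp (hs (r ^ 2))
  have h5 := key.mp (hs (r ^ 5))
  rw [key]
  simp only [remainder, reducedRem, map_add, map_sub, map_mul _ _ _, map_pow (Ideal.Quotient.mk _),
    h0, h1, h2, h5]

theorem coeff_reducedEqn (r : ℂ) (h : PowerSeries ℂ) (k : ℕ) :
    coeff k (reducedEqn r h) = r ^ 6 * coeff k (h * rescale (r ^ 2) h)
      + coeff k (C (4 * r ^ 16 - 9 * r ^ 12 + 2 * r ^ 8))
      + coeff k (X * (remainder r h - C (2 * r ^ 55) * (X ^ 16 * rescale (r ^ 5) h))) := by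
  rw [reducedEqn_eq, (coeff k).map_add, (coeff k).map_add, coeff_C_mul]

/-! ### The formal solution, coefficient by coefficient. -/

/-- The coefficients of the solution `h` of `reducedEqn r h = 0` with `h(0) = ρ`. -/
noncomputable def solCoeff (r ρ : ℂ) (k : ℕ) : ℂ :=
  if k = 0 then ρ else
    -coeff k (reducedEqn r (PowerSeries.mk fun i => if _ : i < k then solCoeff r ρ i else 0))
      / (r ^ 6 * ρ * (1 + (r ^ 2) ^ k))
termination_by k

/-- The solution of `reducedEqn r h = 0` with `h(0) = ρ`. -/
noncomputable def solSeries (r ρ : ℂ) : PowerSeries ℂ := PowerSeries.mk (solCoeff r ρ)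

/-- The truncation of `solSeries r ρ` to degrees less than `k`. -/
noncomputable def solTrunc (r ρ : ℂ) (k : ℕ) : PowerSeries ℂ :=
  PowerSeries.mk fun i => if i < k then solCoeff r ρ i else 0

theorem solCoeff_zero (r ρ : ℂ) : solCoeff r ρ 0 = ρ := by
  rw [solCoeff, if_pos rfl]

theorem solCoeff_of_ne_zero (r ρ : ℂ) {k : ℕ} (hk : k ≠ 0) :
    solCoeff r ρ k = -coeff k (reducedEqn r (solTrunc r ρ k)) / (r ^ 6 * ρ * (1 + (r ^ 2) ^ k)) := by
  rw [solCoeff, if_neg hk]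
  simp only [solTrunc, dite_eq_ite]

theorem X_pow_dvd_solSeries_sub (r ρ : ℂ) (k : ℕ) :
    X ^ k ∣ solSeries r ρ - solTrunc r ρ k := by
  rw [X_pow_dvd_iff]
  intro m hm
  simp [solSeries, solTrunc, hm]

theorem norm_one_add_pow_ge {r : ℂ} (hr : 1 < ‖r‖) {k : ℕ} (hk : k ≠ 0) :
    (1 - (‖r‖ ^ 2)⁻¹) * (‖r‖ ^ 2) ^ k ≤ ‖1 + (r ^ 2) ^ k‖ := by
  have h1 : ‖(r ^ 2) ^ k‖ - ‖(1 : ℂ)‖ ≤ ‖1 + (r ^ 2) ^ k‖ := by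
    rw [add_comm]
    exact norm_sub_le_norm_add _ _
  rw [norm_pow, norm_pow, norm_one] at h1
  refine le_trans ?_ h1
  have h2 : 1 < ‖r‖ ^ 2 := one_lt_pow₀ hr two_ne_zero
  have h3 : ‖r‖ ^ 2 ≤ (‖r‖ ^ 2) ^ k := le_self_pow₀ h2.le hk
  have h4 : 1 ≤ (‖r‖ ^ 2)⁻¹ * (‖r‖ ^ 2) ^ k := by
    rw [inv_mul_eq_div, le_div_iff₀ (by positivity)]
    linarith
  linarith

theorem one_add_pow_ne_zero {r : ℂ} (hr : 1 < ‖r‖) {k : ℕ} (hk : k ≠ 0) :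
    1 + (r ^ 2) ^ k ≠ 0 := by
  rw [← norm_pos_iff]
  refine lt_of_lt_of_le ?_ (norm_one_add_pow_ge hr hk)
  have h2 : 1 < ‖r‖ ^ 2 := one_lt_pow₀ hr two_ne_zero
  have h3 : (‖r‖ ^ 2)⁻¹ < 1 := inv_lt_one_of_one_lt₀ h2
  have h4 : 0 < 1 - (‖r‖ ^ 2)⁻¹ := by linarith
  positivity

/-- The terms behind the factor X see only coefficients below k, so the new coefficient enters
through h(t)h(r²t) alone, once from each factor. -/
theorem coeff_reducedEqn_of_X_pow_dvd {r : ℂ} {k : ℕ} (hk : k ≠ 0) {x y : PowerSeries ℂ}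
    (h : X ^ k ∣ x - y) (hy : coeff k y = 0) :
    coeff k (reducedEqn r x) = coeff k (reducedEqn r y)
      + r ^ 6 * coeff 0 y * (1 + (r ^ 2) ^ k) * coeff k x := by
  have hrem : coeff k (X * (remainder r x - C (2 * r ^ 55) * (X ^ 16 * rescale (r ^ 5) x)))
      = coeff k (X * (remainder r y - C (2 * r ^ 55) * (X ^ 16 * rescale (r ^ 5) y))) := by
    rw [← sub_eq_zero, ← map_sub]
    refine X_pow_dvd_iff.mp ?_ k (Nat.lt_succ_self k)
    rw [← mul_sub, pow_succ']
    refine mul_dvd_mul_left _ ?_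
    have h1 := X_pow_dvd_remainder_sub r h
    have h2 : X ^ k ∣ rescale (r ^ 5) x - rescale (r ^ 5) y := by
      rw [← map_sub]; exact X_pow_dvd_rescale _ h
    have h3 : remainder r x - C (2 * r ^ 55) * (X ^ 16 * rescale (r ^ 5) x)
        - (remainder r y - C (2 * r ^ 55) * (X ^ 16 * rescale (r ^ 5) y))
        = (remainder r x - remainder r y)
          - C (2 * r ^ 55) * X ^ 16 * (rescale (r ^ 5) x - rescale (r ^ 5) y) := by ring
    rw [h3]
    exact dvd_sub h1 (h2.mul_left _)
  obtain ⟨e, he⟩ := h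
  obtain rfl : x = y + X ^ k * e := by rw [← he]; ring
  have he0 : coeff k (y + X ^ k * e) = coeff 0 e := by
    rw [map_add, hy, coeff_X_pow_mul', if_pos le_rfl, Nat.sub_self, zero_add]
  have hquad : coeff k ((y + X ^ k * e) * rescale (r ^ 2) (y + X ^ k * e))
      = coeff k (y * rescale (r ^ 2) y) + coeff 0 y * (1 + (r ^ 2) ^ k) * coeff 0 e := by
    have h1 : (y + X ^ k * e) * rescale (r ^ 2) (y + X ^ k * e)
        = y * rescale (r ^ 2) y + X ^ k * (e * rescale (r ^ 2) y
          + C ((r ^ 2) ^ k) * rescale (r ^ 2) e * y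
          + X ^ k * (C ((r ^ 2) ^ k) * e * rescale (r ^ 2) e)) := by
      simp only [map_add, map_mul, map_pow, rescale_X]
      ring
    rw [h1, map_add, coeff_X_pow_mul', if_pos le_rfl, Nat.sub_self]
    have hX : constantCoeff ((X : PowerSeries ℂ) ^ k) = 0 := by
      rw [map_pow, constantCoeff_X, zero_pow hk]
    have hres : ∀ z : PowerSeries ℂ, constantCoeff (rescale (r ^ 2) z) = constantCoeff z :=
      fun z => by
        rw [← coeff_zero_eq_constantCoeff_apply, coeff_rescale, pow_zero, one_mul,
          coeff_zero_eq_constantCoeff_apply]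
    simp only [coeff_zero_eq_constantCoeff_apply, map_add, map_mul, hX, hres, constantCoeff_C]
    ring
  rw [coeff_reducedEqn, coeff_reducedEqn, hrem, hquad, he0]
  ring

theorem coeff_zero_solTrunc (r ρ : ℂ) {k : ℕ} (hk : k ≠ 0) : coeff 0 (solTrunc r ρ k) = ρ := by
  rw [solTrunc, coeff_mk, if_pos (Nat.pos_of_ne_zero hk), solCoeff_zero]

theorem coeff_self_solTrunc (r ρ : ℂ) (k : ℕ) : coeff k (solTrunc r ρ k) = 0 := by
  rw [solTrunc, coeff_mk, if_neg (lt_irrefl k)]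

theorem reducedEqn_solSeries {r ρ : ℂ} (hr : 1 < ‖r‖) (hρ : ρ ≠ 0)
    (h : r ^ 6 * ρ ^ 2 + (4 * r ^ 16 - 9 * r ^ 12 + 2 * r ^ 8) = 0) :
    reducedEqn r (solSeries r ρ) = 0 := by
  have hr0 : r ≠ 0 := by rintro rfl; simp at hr; linarith
  ext k
  rw [map_zero]
  rcases eq_or_ne k 0 with rfl | hk
  · rw [reducedEqn_eq]
    have h0 : constantCoeff (solSeries r ρ) = ρ := by
      rw [← coeff_zero_eq_constantCoeff_apply, solSeries, coeff_mk, solCoeff_zero]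
    have h1 : constantCoeff (rescale (r ^ 2) (solSeries r ρ)) = ρ := by
      rw [← coeff_zero_eq_constantCoeff_apply, coeff_rescale, pow_zero, one_mul,
        coeff_zero_eq_constantCoeff_apply, h0]
    rw [coeff_zero_eq_constantCoeff_apply, map_add, map_add, map_mul, map_mul, map_mul,
      constantCoeff_X, constantCoeff_C, constantCoeff_C, h0, h1]
    linear_combination h
  · rw [coeff_reducedEqn_of_X_pow_dvd hk (X_pow_dvd_solSeries_sub r ρ k)
      (coeff_self_solTrunc r ρ k), coeff_zero_solTrunc r ρ hk]
    have h1 := one_add_pow_ne_zero hr hk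
    have h2 : coeff k (solSeries r ρ) = _ := (coeff_mk _ _).trans (solCoeff_of_ne_zero r ρ hk)
    rw [h2]
    field_simp
    ring

/-! ### An a priori Gaussian bound. -/

theorem GaussBound.nonneg {a b C : ℝ} {x : PowerSeries ℂ} (h : GaussBound a b C x) : 0 ≤ C := by
  have h0 := (norm_nonneg _).trans (h 0)
  exact nonneg_of_mul_nonneg_left h0 (Real.exp_pos _)

theorem rescale_const (c ρ : ℂ) : rescale c (C ρ : PowerSeries ℂ) = C ρ := by
  ext n
  rw [coeff_rescale, coeff_C]
  split_ifs with h
  · subst h; simp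
  · simp

theorem coeff_mul_rescale_add_const {k : ℕ} (hk : k ≠ 0) (c ρ : ℂ) {G : PowerSeries ℂ}
    (hG : coeff k G = 0) :
    coeff k ((G + C ρ) * rescale c (G + C ρ)) = coeff k (G * rescale c G) := by
  have hCr := rescale_const c ρ
  have h1 : (G + C ρ) * rescale c (G + C ρ)
      = G * rescale c G + (C ρ * rescale c G + (C ρ * G + C (ρ ^ 2))) := by
    rw [map_add, hCr, map_pow]; ring
  rw [h1, map_add, map_add, map_add, coeff_C_mul, coeff_C_mul, coeff_rescale, hG, coeff_C,
    if_neg hk]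
  ring

/-- Strong induction on k, with the constant `D` for nonconstant coefficients small enough to absorb
the quadratic term, and then b large enough to absorb everything behind the factor X. -/
theorem exists_gaussBound_solSeries {a : ℝ} (ha : 0 < a) {r ρ : ℂ} (hr : 1 < ‖r‖) (hρ : ρ ≠ 0)
    (har : 34 * a = 3 * Real.log ‖r‖) : ∃ b K, GaussBound a b K (solSeries r ρ) := by
  have hr0 : r ≠ 0 := by rintro rfl; simp at hr; linarith
  set l := Real.log ‖r‖ with hl
  have hl0 : 0 < l := Real.log_pos hr
  have hlog : ∀ k : ℕ, Real.log ‖r ^ k‖ = k * l := fun k => by rw [norm_pow, Real.log_pow]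
  have hF : ShiftsBound a (2 * l + 2 * a)
      (fun H => remainder r H - C (2 * r ^ 55) * (X ^ 16 * rescale (r ^ 5) H)) := by
    refine ((shiftsBound_remainder ha hr har).mono (by linarith)).sub
      ((ShiftsBound.const _ _ _).mul ha ?_)
    refine (((ShiftsBound.id a).rescale (pow_ne_zero 5 hr0)).X_pow_mul 16).mono ?_
    rw [hlog]
    push_cast
    linarith
  obtain ⟨K, hK, hF⟩ := hF (1 + ‖ρ‖) 0 (by positivity)
  set S := convConst a with hS
  have hS0 : 0 < S := convConst_pos ha
  set m := 1 - (‖r‖ ^ 2)⁻¹ with hm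
  have hm0 : 0 < m := sub_pos.mpr (inv_lt_one_of_one_lt₀ (one_lt_pow₀ hr two_ne_zero))
  have hρ0 : 0 < ‖ρ‖ := norm_pos_iff.mpr hρ
  have hrn : 0 < ‖r‖ := norm_pos_iff.mpr hr0
  -- The quadratic contribution S·D² may use half of the available ‖ρ‖·m·D; D ≤ 1 keeps the
  -- truncations within the constant 1 + ‖ρ‖ already fixed for `K`.
  set D := min 1 (‖ρ‖ * m / (2 * S)) with hD
  have hD0 : 0 < D := by positivity
  have hD1 : D ≤ 1 := min_le_left _ _
  have hD2 : S * D ≤ ‖ρ‖ * m / 2 := by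
    have : D ≤ ‖ρ‖ * m / (2 * S) := min_le_right _ _
    rw [le_div_iff₀ (by positivity)] at this
    linarith
  set δ := ‖r‖ ^ 6 * (‖ρ‖ * m / 2) * D with hδ
  have hδ0 : 0 < δ := by positivity
  -- Chosen so that K·exp(-b) = δ·b·exp(-b) ≤ δ, the other half of the budget.
  set b := K / δ with hb
  have hb0 : 0 ≤ b := by positivity
  have hKb : K * Real.exp (a * ((1 : ℕ) : ℝ) ^ 2 - (b + (2 * l + 2 * a)) * (1 : ℕ)) ≤ δ := by
    have h1 : K = δ * b := by rw [hb]; field_simp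
    have h2 : b * Real.exp (-b) ≤ 1 := by
      rw [Real.exp_neg, ← div_eq_mul_inv, div_le_one (Real.exp_pos _)]
      linarith [Real.add_one_le_exp b]
    calc _ ≤ K * Real.exp (-b) := by
          gcongr
          push_cast
          linarith
      _ = δ * (b * Real.exp (-b)) := by rw [h1]; ring
      _ ≤ δ * 1 := by gcongr
      _ = δ := mul_one _
  have main : ∀ k : ℕ, k ≠ 0 →
      ‖solCoeff r ρ k‖ ≤ D * Real.exp (a * (k : ℝ) ^ 2 + b * k) := by
    intro k
    induction k using Nat.strong_induction_on with
    | _ k ih =>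
      intro hk
      set H := solTrunc r ρ k with hH
      set G := H - C ρ with hG
      have hHG : H = G + C ρ := by rw [hG]; ring
      have hGk : coeff k G = 0 := by
        rw [hG, map_sub, hH, coeff_self_solTrunc, coeff_C, if_neg hk, sub_zero]
      have hGb : GaussBound a b D G := by
        intro i
        rcases eq_or_ne i 0 with rfl | hi
        · rw [hG, map_sub, hH, coeff_zero_solTrunc r ρ hk, coeff_C, if_pos rfl, sub_self,
            norm_zero]
          positivity
        · rw [hG, map_sub, coeff_C, if_neg hi, sub_zero, hH, solTrunc, coeff_mk]
          split_ifs with h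
          · exact ih i h hi
          · rw [norm_zero]; positivity
      have hHb : GaussBound a b (1 + ‖ρ‖) H := by
        rw [hHG]
        exact (hGb.add (GaussBound.const a b ρ)).mono le_rfl (by linarith) (by positivity)
      have h1 := (hF b hb0 H hHb).X_pow_mul hK 1 k
      have h2 := GaussBound.mul ha hD0.le hD0.le
        (hGb.mono (show b ≤ b + 2 * l by linarith) le_rfl hD0.le)
        (by simpa only [hlog, Nat.cast_ofNat] using hGb.rescale (pow_ne_zero 2 hr0)) k
      rw [pow_one, show b + (2 * l + 2 * a) - 2 * a * (1 : ℕ) = b + 2 * l by push_cast; ring]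
        at h1
      have h3 := h1.trans (mul_le_mul_of_nonneg_right hKb (Real.exp_pos _).le)
      have h4 : Real.exp (a * (k : ℝ) ^ 2 + (b + 2 * l) * k)
          = Real.exp (a * (k : ℝ) ^ 2 + b * k) * (‖r‖ ^ 2) ^ k := by
        rw [← pow_mul, ← Real.exp_log hrn, ← Real.exp_nat_mul, ← Real.exp_add, ← hl]
        push_cast
        ring_nf
      have h5 : ‖coeff k (reducedEqn r H)‖ ≤ (‖r‖ ^ 6 * (S * D * D) + δ) *
          (Real.exp (a * (k : ℝ) ^ 2 + b * k) * (‖r‖ ^ 2) ^ k) := by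
        rw [← h4, coeff_reducedEqn, coeff_C, if_neg hk, add_zero, add_mul]
        refine (norm_add_le _ _).trans (add_le_add ?_ h3)
        rw [hHG, coeff_mul_rescale_add_const hk _ _ hGk, norm_mul, norm_pow, mul_assoc]
        gcongr
      have h6 : ‖r‖ ^ 6 * (S * D * D) + δ ≤ ‖r‖ ^ 6 * ‖ρ‖ * m * D := by
        have : ‖r‖ ^ 6 * (S * D * D) ≤ ‖r‖ ^ 6 * (‖ρ‖ * m / 2 * D) := by gcongr
        rw [hδ]; linarith
      rw [solCoeff_of_ne_zero r ρ hk, norm_div, norm_neg, norm_mul, norm_mul, norm_pow]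
      have h7 := norm_one_add_pow_ge hr hk
      have h8 : 0 < ‖1 + (r ^ 2) ^ k‖ := norm_pos_iff.mpr (one_add_pow_ne_zero hr hk)
      rw [div_le_iff₀ (by positivity)]
      calc _ ≤ _ := h5
        _ ≤ (‖r‖ ^ 6 * ‖ρ‖ * m * D) *
          (Real.exp (a * (k : ℝ) ^ 2 + b * k) * (‖r‖ ^ 2) ^ k) := by gcongr
        _ = D * Real.exp (a * (k : ℝ) ^ 2 + b * k) * (‖r‖ ^ 6 * ‖ρ‖ * (m * (‖r‖ ^ 2) ^ k)) := by
          ring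
        _ ≤ _ := by gcongr
  refine ⟨b, max ‖ρ‖ D, fun k => ?_⟩
  rw [solSeries, coeff_mk]
  rcases eq_or_ne k 0 with rfl | hk
  · rw [solCoeff_zero]
    simp
  · refine (main k hk).trans ?_
    gcongr
    exact le_max_right _ _

/-! ### The dominant linear recurrence. -/

/-- Writing h = ρ + Xe extracts ρ h(r²t) from the product; what is left of the convolution is X²
e(t)e(r²t), where X² gains 4a and passing to e costs only 2a. -/
theorem exists_gaussBound_linear_part {a : ℝ} (ha : 0 < a) {r ρ : ℂ} (hr : 1 < ‖r‖)
    (har : 34 * a = 3 * Real.log ‖r‖) {h : PowerSeries ℂ} (h0 : coeff 0 h = ρ)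
    (heq : reducedEqn r h = 0) {b K : ℝ} (hb : GaussBound a b K h) :
    ∃ K', GaussBound a (b + 2 * Real.log ‖r‖ - 2 * a) K'
      (C (r ^ 6 * ρ) * rescale (r ^ 2) h - C (2 * r ^ 55) * (X ^ 17 * rescale (r ^ 5) h)) := by
  have hr0 : r ≠ 0 := by rintro rfl; simp at hr; linarith
  set l := Real.log ‖r‖ with hl
  have hl0 : 0 < l := Real.log_pos hr
  have hlog : ∀ k : ℕ, Real.log ‖r ^ k‖ = k * l := fun k => by rw [norm_pow, Real.log_pow]
  set e : PowerSeries ℂ := PowerSeries.mk fun k => coeff (k + 1) h with he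
  have hhe : h = X * e + C ρ := by
    rw [he, ← h0, coeff_zero_eq_constantCoeff_apply]
    exact (eq_X_mul_shift_add_const h)
  have hCr := rescale_const (r ^ 2) ρ
  have hsplit : C (r ^ 6 * ρ) * rescale (r ^ 2) h - C (2 * r ^ 55) * (X ^ 17 * rescale (r ^ 5) h)
      = -(C (r ^ 6 * ρ) * h + C (r ^ 8) * (X ^ 2 * (e * rescale (r ^ 2) e))
        + C (4 * r ^ 16 - 9 * r ^ 12 + 2 * r ^ 8 - r ^ 6 * ρ ^ 2) + X ^ 1 * remainder r h) := by
    have h2 : rescale (r ^ 2) h = C (r ^ 2) * X * rescale (r ^ 2) e + C ρ := by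
      conv_lhs => rw [hhe]
      rw [map_add, map_mul, rescale_X, hCr]
    have hq : h * rescale (r ^ 2) h = C ρ * rescale (r ^ 2) h + C ρ * (h - C ρ)
        + C (r ^ 2) * (X ^ 2 * (e * rescale (r ^ 2) e)) := by
      rw [h2]
      conv_lhs => rw [hhe]
      conv_rhs => rw [hhe]
      ring
    rw [reducedEqn_eq] at heq
    have h8 : (C (r ^ 8) : PowerSeries ℂ) = C (r ^ 6) * C (r ^ 2) := by
      rw [← map_mul]; ring_nf
    rw [hq] at heq
    rw [map_sub C (_ + _) _, map_mul C (r ^ 6) ρ, map_mul C (r ^ 6) (ρ ^ 2), map_pow C ρ, h8]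
    linear_combination heq
  obtain ⟨K₁, hK₁, hrem⟩ := shiftsBound_remainder ha hr har K b hb.nonneg
  have hrem := (hrem b le_rfl h hb).X_pow_mul hK₁ 1
  have hE := hb.divX
  rw [← he] at hE
  have hE2 := hE.rescale (pow_ne_zero 2 hr0)
  rw [hlog] at hE2
  have hEE := (hE.mono (show b + 2 * a ≤ b + 2 * a + (2 : ℕ) * l by push_cast; linarith) le_rfl
    hE.nonneg).mul ha hE.nonneg hE2.nonneg hE2
  have hEE := hEE.X_pow_mul hEE.nonneg 2
  have hC : ∀ c, GaussBound a (b + 2 * l - 2 * a) ‖c‖ (C c) := GaussBound.const _ _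
  have t1 := hb.mono (show b ≤ b + 2 * l - 2 * a by linarith) le_rfl hb.nonneg
  have t2 := hEE.mono (show _ ≤ b + 2 * l - 2 * a by push_cast; linarith) le_rfl hEE.nonneg
  have t3 := hrem.mono (show _ ≤ b + 2 * l - 2 * a by push_cast; linarith) le_rfl hrem.nonneg
  rw [hsplit]
  exact ⟨_, ((((hC _).mul ha (hC _).nonneg t1.nonneg t1).add
    ((hC _).mul ha (hC _).nonneg t2.nonneg t2)).add (hC _)).add t3 |>.neg⟩

theorem exists_le_geometric_of_step {u : ℕ → ℂ} {p : ℕ} (hp : p ≠ 0) {K σ : ℝ} (hσ : 1 < σ)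
    (h : ∀ k, ‖u (k + p) - u k‖ ≤ K * σ ^ k) : ∃ K', ∀ k, ‖u k‖ ≤ K' * σ ^ k := by
  have hσ0 : 0 < σ := by linarith
  have hK : 0 ≤ K := by
    have := (norm_nonneg _).trans (h 0)
    simpa using this
  have hσp : 0 < σ ^ p - 1 := sub_pos.mpr (one_lt_pow₀ hσ hp)
  set A := ∑ i ∈ Finset.range p, ‖u i‖ with hA
  have hA0 : 0 ≤ A := Finset.sum_nonneg fun _ _ => norm_nonneg _
  have hB0 : 0 ≤ K / (σ ^ p - 1) := by positivity
  refine ⟨A + K / (σ ^ p - 1), fun k => ?_⟩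
  induction k using Nat.strong_induction_on with
  | _ k ih =>
    rcases lt_or_ge k p with hk | hk
    · calc ‖u k‖ ≤ A := Finset.single_le_sum (f := fun i => ‖u i‖)
            (fun _ _ => norm_nonneg _) (Finset.mem_range.mpr hk)
        _ ≤ (A + K / (σ ^ p - 1)) * 1 := by linarith
        _ ≤ _ := by
          gcongr
          exact one_le_pow₀ hσ.le
    · obtain ⟨j, rfl⟩ := Nat.exists_eq_add_of_le' hk
      have h1 := ih j (by omega)
      have h2 : ‖u (j + p)‖ ≤ ‖u j‖ + ‖u (j + p) - u j‖ := by
        have := norm_add_le (u j) (u (j + p) - u j)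
        rwa [add_sub_cancel] at this
      have h3 : K ≤ (A + K / (σ ^ p - 1)) * (σ ^ p - 1) := by
        rw [add_mul, div_mul_cancel₀ _ hσp.ne']
        have := mul_nonneg hA0 hσp.le
        linarith
      have h4 := h j
      calc ‖u (j + p)‖ ≤ (A + K / (σ ^ p - 1)) * σ ^ j + K * σ ^ j := by linarith
        _ ≤ (A + K / (σ ^ p - 1)) * σ ^ j + (A + K / (σ ^ p - 1)) * (σ ^ p - 1) * σ ^ j := by
          gcongr
        _ = _ := by rw [pow_add]; ring

/-- Summable geometric increments make each subsequence of step p Cauchy. -/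
theorem exists_tendsto_of_step {u : ℕ → ℂ} {p : ℕ} (hp : p ≠ 0) {K σ : ℝ} (hσ0 : 0 ≤ σ)
    (hσ : σ < 1) (h : ∀ k, ‖u (k + p) - u k‖ ≤ K * σ ^ k) (j : ℕ) :
    ∃ c, Filter.Tendsto (fun k => u (p * k + j)) Filter.atTop (nhds c) := by
  refine cauchySeq_tendsto_of_complete
    (cauchySeq_of_le_geometric (σ ^ p) (K * σ ^ j) (pow_lt_one₀ hσ0 hσ hp) fun k => ?_)
  rw [dist_comm, dist_eq_norm, show p * (k + 1) + j = p * k + j + p by ring]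
  refine (h _).trans (le_of_eq ?_)
  rw [pow_add, pow_mul]
  ring

/-! ### Comparison with the model sequence; the offset 7 is that of f_{k+7} = h_k. -/

theorem norm_comparison (L M : ℂ) (k : ℕ) :
    ‖comparison L M (k + 7)‖ = ‖comparison L M 7‖ *
      Real.exp (3 * L.re / 68 * (k : ℝ) ^ 2 + (M.re / 17 - 21 * L.re / 68) * k) := by
  have key : ∀ n : ℕ, ‖comparison L M n‖
      = Real.exp ((3 * (n : ℝ) ^ 2 - 63 * n) / 68 * L.re + n / 17 * M.re) := fun n => by
    rw [comparison, norm_mul, Complex.norm_exp, Complex.norm_exp, Real.exp_add,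
      show ((3 * (n : ℂ) ^ 2 - 63 * n) / 68) = (((3 * (n : ℝ) ^ 2 - 63 * n) / 68 : ℝ) : ℂ) by
        push_cast; ring,
      show ((n : ℂ) / 17) = (((n : ℝ) / 17 : ℝ) : ℂ) by push_cast; ring,
      Complex.re_ofReal_mul, Complex.re_ofReal_mul]
  rw [key, key, ← Real.exp_add]
  push_cast
  ring_nf

theorem comparison_ne_zero (L M : ℂ) (n : ℕ) : comparison L M n ≠ 0 :=
  mul_ne_zero (Complex.exp_ne_zero _) (Complex.exp_ne_zero _)

theorem comparison_add {L M r ρ : ℂ} (hL : Complex.exp (L / 2) = r)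
    (hM : Complex.exp M = 2 / ρ) (k : ℕ) :
    comparison L M (k + 17 + 7) = comparison L M (k + 7) * (r ^ (3 * k + 15) * (2 / ρ)) := by
  rw [← hM, ← hL, ← Complex.exp_nat_mul]
  simp only [comparison, ← Complex.exp_add]
  push_cast
  ring_nf

section Asymptotics

variable {r ρ L M : ℂ} {h : PowerSeries ℂ}

/-- Dividing coefficient k + 17 of the linear part by r⁶ρ r^{2(k+17)} times the comparison term
turns it into the increment of the normalized coefficients. -/
theorem exists_norm_step_le (hr : 1 < ‖r‖) (hρ : ρ ≠ 0) (hL : Complex.exp (L / 2) = r)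
    (hM : Complex.exp M = 2 / ρ) (h0 : coeff 0 h = ρ) (heq : reducedEqn r h = 0) {b K : ℝ}
    (hb : GaussBound (3 * L.re / 68) b K h) :
    ∃ K', ∀ k, ‖coeff (k + 17) h / comparison L M (k + 17 + 7)
        - coeff k h / comparison L M (k + 7)‖
      ≤ K' * Real.exp (b - 2 * (3 * L.re / 68) - (M.re / 17 - 21 * L.re / 68)) ^ k := by
  have hr0 : r ≠ 0 := by rintro rfl; simp at hr; linarith
  have hl : Real.log ‖r‖ = L.re / 2 := by
    rw [← hL, Complex.norm_exp, Real.log_exp, Complex.div_ofNat_re]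
  have hl0 : 0 < Real.log ‖r‖ := Real.log_pos hr
  set a := 3 * L.re / 68 with ha
  set b₀ := M.re / 17 - 21 * L.re / 68 with hb₀
  obtain ⟨K', hK'⟩ := exists_gaussBound_linear_part (by linarith : 0 < a) hr (by rw [hl]; linarith)
    h0 heq hb
  set σ := b - 2 * a - b₀ with hσ
  set D := ‖r ^ 6 * ρ‖ * ‖comparison L M 7‖ with hD
  have hD0 : 0 < D := mul_pos (norm_pos_iff.mpr (mul_ne_zero (pow_ne_zero _ hr0) hρ))
    (norm_pos_iff.mpr (comparison_ne_zero _ _ _))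
  refine ⟨K' / D * Real.exp (σ * 17), fun k => ?_⟩
  have h1 := hK' (k + 17)
  rw [map_sub, coeff_C_mul, coeff_C_mul, coeff_rescale, coeff_X_pow_mul, coeff_rescale] at h1
  have hcomp := comparison_add hL hM k
  have hc0 := comparison_ne_zero L M (k + 7)
  have h2 : coeff (k + 17) h / comparison L M (k + 17 + 7) - coeff k h / comparison L M (k + 7)
      = (r ^ 6 * ρ * ((r ^ 2) ^ (k + 17) * coeff (k + 17) h)
        - 2 * r ^ 55 * ((r ^ 5) ^ k * coeff k h))
        / (r ^ 6 * ρ * (r ^ 2) ^ (k + 17) * comparison L M (k + 17 + 7)) := by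
    rw [hcomp]
    field_simp
    ring
  rw [h2, norm_div, norm_mul _ (comparison _ _ _), norm_comparison, norm_mul _ ((r ^ 2) ^ (k + 17))]
  have h3 : ‖(r ^ 2) ^ (k + 17)‖ = Real.exp (2 * Real.log ‖r‖ * ((k + 17 : ℕ) : ℝ)) := by
    rw [norm_pow, norm_pow, ← pow_mul]
    nth_rewrite 1 [← Real.exp_log (norm_pos_iff.mpr hr0)]
    rw [← Real.exp_nat_mul]
    push_cast
    ring_nf
  rw [h3]
  have h4 : ‖r ^ 6 * ρ‖ * Real.exp (2 * Real.log ‖r‖ * ((k + 17 : ℕ) : ℝ)) *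
      (‖comparison L M 7‖ *
        Real.exp (a * ((k + 17 : ℕ) : ℝ) ^ 2 + b₀ * ((k + 17 : ℕ) : ℝ)))
      = D * Real.exp (a * ((k + 17 : ℕ) : ℝ) ^ 2
          + (b₀ + 2 * Real.log ‖r‖) * ((k + 17 : ℕ) : ℝ)) := by
    rw [add_mul, ← add_assoc, Real.exp_add _ (2 * Real.log ‖r‖ * ((k + 17 : ℕ) : ℝ)), hD]
    ring
  rw [h4, div_le_iff₀ (by positivity)]
  refine h1.trans (le_of_eq ?_)
  rw [← Real.exp_nat_mul]
  have h5 : a * ((k + 17 : ℕ) : ℝ) ^ 2 + (b + 2 * Real.log ‖r‖ - 2 * a) * ((k + 17 : ℕ) : ℝ)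
      = σ * 17 + (k * σ) + (a * ((k + 17 : ℕ) : ℝ) ^ 2
          + (b₀ + 2 * Real.log ‖r‖) * ((k + 17 : ℕ) : ℝ)) := by
    rw [hσ]; push_cast; ring
  rw [h5, Real.exp_add, Real.exp_add (σ * 17)]
  field_simp

theorem exists_tendsto_coeff_div_comparison (hr : 1 < ‖r‖) (hρ : ρ ≠ 0)
    (hL : Complex.exp (L / 2) = r) (hM : Complex.exp M = 2 / ρ) (h0 : coeff 0 h = ρ)
    (heq : reducedEqn r h = 0) {b K : ℝ} (hb : GaussBound (3 * L.re / 68) b K h) (j : ℕ) :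
    ∃ c, Filter.Tendsto (fun k : ℕ => coeff (17 * k + j) h / comparison L M (17 * k + j + 7))
      Filter.atTop (nhds c) := by
  have hl : Real.log ‖r‖ = L.re / 2 := by
    rw [← hL, Complex.norm_exp, Real.log_exp, Complex.div_ofNat_re]
  have hl0 : 0 < Real.log ‖r‖ := Real.log_pos hr
  set a := 3 * L.re / 68 with ha
  have ha0 : 0 < a := by linarith
  set b₀ := M.re / 17 - 21 * L.re / 68 with hb₀
  -- Odd multiples of a avoid increment ratio 1: the ratio is exp((2N+1)a) > 1 at each descent, and
  -- exp(-a) < 1 once b₀ + a is reached.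
  have descend : ∀ N : ℕ, (∃ K, GaussBound a (b₀ + (2 * N + 1) * a) K h) →
      ∃ K, GaussBound a (b₀ + a) K h := by
    intro N
    induction N with
    | zero => simp
    | succ N ih =>
      rintro ⟨K, hK⟩
      refine ih ?_
      obtain ⟨K₁, hK₁⟩ := exists_norm_step_le hr hρ hL hM h0 heq hK
      rw [show b₀ + (2 * ((N + 1 : ℕ) : ℝ) + 1) * a - 2 * a - b₀ = (2 * N + 1) * a by
        push_cast; ring] at hK₁
      obtain ⟨K₂, hK₂⟩ := exists_le_geometric_of_step
        (u := fun k => coeff k h / comparison L M (k + 7)) (p := 17) (by norm_num)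
        (Real.one_lt_exp_iff.mpr (by positivity)) hK₁
      refine ⟨K₂ * ‖comparison L M 7‖, fun k => ?_⟩
      have h1 := hK₂ k
      rw [norm_div, div_le_iff₀ (norm_pos_iff.mpr (comparison_ne_zero _ _ _)), norm_comparison,
        ← Real.exp_nat_mul, ← ha, ← hb₀] at h1
      refine h1.trans (le_of_eq ?_)
      rw [show a * (k : ℝ) ^ 2 + (b₀ + (2 * N + 1) * a) * k
        = k * ((2 * N + 1) * a) + (a * (k : ℝ) ^ 2 + b₀ * k) by ring,
        Real.exp_add (k * ((2 * N + 1) * a))]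
      ring
  obtain ⟨N, hN⟩ := exists_nat_ge ((b - b₀) / a)
  rw [div_le_iff₀ ha0] at hN
  have hNa : 0 ≤ (N : ℝ) * a := by positivity
  obtain ⟨K₁, hK₁⟩ := descend N ⟨K, hb.mono (by linarith) le_rfl hb.nonneg⟩
  obtain ⟨K₂, hK₂⟩ := exists_norm_step_le hr hρ hL hM h0 heq hK₁
  exact exists_tendsto_of_step (u := fun k => coeff k h / comparison L M (k + 7)) (p := 17)
    (by norm_num) (Real.exp_pos _).le (Real.exp_lt_one_iff.mpr (by linarith)) hK₂ j

end Asymptotics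

end GaussianGrowth

/-! ### The main theorem. -/

theorem proposition4p1 :
    ∃ E : Set ℂ, E.Countable ∧ ∀ q : ℂ, 1 < ‖q‖ → q ∉ E →
      ∀ r : ℂ, r ^ 2 = q →
      ∀ ρ : ℂ, ρ ^ 2 = -q * (q ^ 2 - 2) * (2 * q - 1) * (2 * q + 1) →
        ∃ f : PowerSeries ℂ,
          IsHalfPowerSolution r (cfaPolynomial q) f ∧
          HasExpansion f ρ ∧
          ρ ≠ 0 ∧
          ∀ L M : ℂ, Complex.exp (L / 2) = r → Complex.exp M = 2 / ρ →
            ∃ c : Fin 17 → ℂ, ∀ m : Fin 17,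
              Filter.Tendsto
                (fun k : ℕ =>
                  PowerSeries.coeff (17 * k + (m : ℕ)) f / comparison L M (17 * k + (m : ℕ)))
                Filter.atTop (nhds (c m)) := by
  have hsqrt : ((Real.sqrt 2 : ℝ) : ℂ) ^ 2 = 2 := by
    rw [← Complex.ofReal_pow, Real.sq_sqrt (by norm_num)]
    norm_num
  -- Only q² = 2 must be excluded: the other factors of ρ² cannot vanish when |q| > 1.
  refine ⟨{((Real.sqrt 2 : ℝ) : ℂ), -((Real.sqrt 2 : ℝ) : ℂ)},
    (Set.toFinite _).countable, ?_⟩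
  rintro q hq hqE r rfl ρ hρ
  have hq2 : (r ^ 2) ^ 2 - 2 ≠ 0 := fun h => hqE <| by
    rw [Set.mem_insert_iff, Set.mem_singleton_iff, ← sq_eq_sq_iff_eq_or_eq_neg, hsqrt]
    linear_combination h
  have hr : 1 < ‖r‖ := by
    rw [norm_pow] at hq
    exact (one_lt_sq_iff₀ (norm_nonneg _)).mp hq
  have hr0 : r ≠ 0 := by rintro rfl; simp at hr; linarith
  have hhalf : ∀ s : ℂ, ‖s‖ = 1 → 2 * r ^ 2 - s ≠ 0 := fun s hs h => by
    have h1 : ‖2 * r ^ 2‖ = 1 := by rw [sub_eq_zero.mp h, hs]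
    rw [norm_mul, Complex.norm_ofNat] at h1
    linarith
  have hρ0 : ρ ≠ 0 := by
    intro h
    rw [h, zero_pow two_ne_zero] at hρ
    have h1 := hhalf 1 (by simp)
    have h2 : 2 * r ^ 2 + 1 ≠ 0 := by simpa using hhalf (-1) (by simp)
    exact mul_ne_zero (mul_ne_zero (mul_ne_zero (neg_ne_zero.mpr (pow_ne_zero 2 hr0)) hq2) h1) h2
      hρ.symm
  set h := solSeries r ρ with hh
  have hcoeff0 : PowerSeries.coeff 0 h = ρ := by
    rw [hh, solSeries, PowerSeries.coeff_mk, solCoeff_zero]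
  have heq : reducedEqn r h = 0 := reducedEqn_solSeries hr hρ0 (by
    linear_combination r ^ 6 * hρ)
  refine ⟨PowerSeries.X ^ 4 * (1 + PowerSeries.X ^ 3 * h), ?_, ?_, hρ0, ?_⟩
  · rw [IsHalfPowerSolution, qSubst_cfaPolynomial hr0, heq, mul_zero]
  · have h1 : (PowerSeries.X : PowerSeries ℂ) ∣ h - PowerSeries.C ρ := by
      rw [PowerSeries.X_dvd_iff, map_sub, ← PowerSeries.coeff_zero_eq_constantCoeff_apply, hcoeff0,
        PowerSeries.constantCoeff_C, sub_self]
    obtain ⟨e, he⟩ := h1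
    refine ⟨e, ?_⟩
    linear_combination PowerSeries.X ^ 7 * he
  · intro L M hL hM
    have hl : Real.log ‖r‖ = L.re / 2 := by
      rw [← hL, Complex.norm_exp, Real.log_exp, Complex.div_ofNat_re]
    have hl0 : 0 < Real.log ‖r‖ := Real.log_pos hr
    obtain ⟨b, K, hb⟩ := exists_gaussBound_solSeries (a := 3 * L.re / 68) (by linarith) hr hρ0
      (by linarith)
    choose c hc using exists_tendsto_coeff_div_comparison hr hρ0 hL hM hcoeff0 heq hb
    -- One step in k is dropped so that 17(k+1) + m = 17k + (m+10) + 7; the index then also exceeds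
    -- 4, so the term X⁴ plays no role.
    refine ⟨fun m => c (m + 10), fun m => ?_⟩
    rw [← Filter.tendsto_add_atTop_iff_nat 1]
    refine (hc (m + 10)).congr fun k => ?_
    rw [show 17 * (k + 1) + (m : ℕ) = 17 * k + (m + 10) + 7 by ring]
    congr 1
    rw [show (PowerSeries.X : PowerSeries ℂ) ^ 4 * (1 + PowerSeries.X ^ 3 * h)
      = PowerSeries.X ^ 4 + PowerSeries.X ^ 7 * h by ring, map_add, PowerSeries.coeff_X_pow,
      if_neg (by omega), PowerSeries.coeff_X_pow_mul, zero_add]
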